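/- Let $\mu$ be a finite nonnegative Borel measure with infinite support on the unit circle $\mathbb{S}^1=\{z\in\mathbb{C}:|z|=1\}$, and let $(Q_k)_{k\ge 0}$ be its monic orthogonal polynomials: $Q_k$ is monic of degree $k$ and $\int Q_k\overline{Q_m}\,d\mu=0$ for $k\ne m$. Fix $n\ge 1$. For $b\in\mathbb{S}^1$ let $$P(z;b)=zQ_{n-1}(z)-\overline{b}\,Q_{n-1}^*(z),\qquad Q_{n-1}^*(z)=z^{n-1}\overline{Q_{n-1}(1/\overline{z})},$$ be the monic paraorthogonal polynomial on the unit circle (POPUC) of degree $n$ with parameter $b$. Let $J\subseteq\mathbb{R}$ be an open interval, $t_0\in J$, and let $b:J\to\mathbb{S}^1$ be differentiable in a neighbourhood of $t_0$. Suppose that $P(\zeta_0;b(t_0))=0$. For $r>0$ write $C_r(\zeta_0)=\{z\in\mathbb{S}^1:|z-\zeta_0|<r\}$ and $I_r=(t_0-r,t_0+r)$. Then there exist $\epsilon>0$ and $\delta>0$ with $I_\epsilon\subseteq J$, and a function $\zeta:I_\epsilon\to C_\delta(\zeta_0)$ with $\zeta(t_0)=\zeta_0$, such that for each $t\in I_\epsilon$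 the point $\zeta(t)$ is the unique zero of $P(\cdot;b(t))$ in $C_\delta(\zeta_0)$. Moreover, $\zeta$ is differentiable on $I_\epsilon$. Furthermore, $\zeta(t)$ moves strictly counterclockwise along $\mathbb{S}^1$ as $t$ increases wherever $i\,\overline{b(t)}\,b'(t)$ is strictly positive; that is, there is a differentiable function $\varphi:I_\epsilon\to\mathbb{R}$ with $\zeta(t)=e^{i\varphi(t)}$ such that $\varphi'(t)>0$ for every $t\in I_\epsilon$ with $i\,\overline{b(t)}\,b'(t)>0$, and $\varphi$ is strictly increasing on every interval $K\subseteq I_\epsilon$ on which $i\,\overline{b(t)}\,b'(t)>0$ (in particular on $I_\epsilon$ itself, if the condition holds there). -/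

import Mathlib

open Polynomial MeasureTheory
open scoped ComplexConjugate ComplexOrder Topology

namespace POPUC

/-- The unit circle `𝕊¹` as a subset of `ℂ`; its coercion to a type carries the subspace topology
and the Borel `σ`-algebra. -/
abbrev unitCircle : Set ℂ := Metric.sphere 0 1

/-- The sesquilinear form `∫ p(e^{iθ}) * conj (q(e^{iθ})) dμ(θ)` on polynomials. -/
noncomputable def polyInner (μ : Measure unitCircle) (p q : ℂ[X]) : ℂ :=
  ∫ z : unitCircle, p.eval (z : ℂ) * conj (q.eval (z : ℂ)) ∂μ

/-- `Q` is a sequence of monic orthogonal polynomials on the unit circle (monic OPUC) for `μ`. -/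
structure IsMonicOPUC (μ : Measure unitCircle) (Q : ℕ → ℂ[X]) : Prop where
  monic : ∀ n, (Q n).Monic
  natDegree_eq : ∀ n, (Q n).natDegree = n
  orthogonal : ∀ n m, n ≠ m → polyInner μ (Q n) (Q m) = 0
  norm_ne_zero : ∀ n, polyInner μ (Q n) (Q n) ≠ 0

/-- The monic OPUC `Q_n(·; dμ)`, built from `1, z, z², …` by Gram-Schmidt. When `μ` is finite with
infinite support, this is the unique sequence satisfying `IsMonicOPUC μ`: see
`isMonicOPUC_opuc` and `IsMonicOPUC.eq_opuc` below. -/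
noncomputable def opuc (μ : Measure unitCircle) (n : ℕ) : ℂ[X] :=
  X ^ n - ∑ k : Fin n,
    C (polyInner μ (X ^ n) (opuc μ k) / polyInner μ (opuc μ k) (opuc μ k)) * opuc μ k
termination_by n
decreasing_by all_goals exact k.2

/-- The reversed polynomial `Q^*(z) = z ^ n * conj (Q (1 / conj z))`, where `Q` is regarded as a
polynomial of degree (at most) `n`: the coefficient of `z ^ j` is the conjugate of the coefficient
of `z ^ (n - j)` in `Q`. See `eval_reversedConj`. -/
noncomputable def reversedConj (n : ℕ) (Q : ℂ[X]) : ℂ[X] :=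
  (Q.map (starRingEnd ℂ)).reflect n

/-- The monic paraorthogonal polynomial on the unit circle (POPUC) of degree `n ≥ 1` with
parameter `b ∈ 𝕊¹`: `P_n(z; b; dμ) = z Q_{n-1}(z) - conj b * Q_{n-1}^*(z)`. -/
noncomputable def popuc (μ : Measure unitCircle) (n : ℕ) (b : ℂ) : ℂ[X] :=
  X * opuc μ (n - 1) - C (conj b) * reversedConj (n - 1) (opuc μ (n - 1))

/-- The arc `C_r(c)`: the part of the unit circle in the open disk of radius `r` centred at `c`. -/
def arc (c : ℂ) (r : ℝ) : Set ℂ := Metric.ball c r ∩ unitCircle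

/-! ### The definitions agree with their defining properties -/

theorem eval_reversedConj {n : ℕ} {Q : ℂ[X]} (hQ : Q.natDegree ≤ n) {z : ℂ} (hz : z ≠ 0) :
    (reversedConj n Q).eval z = z ^ n * conj (Q.eval (1 / conj z)) := by
  have hz' : z⁻¹ ≠ 0 := inv_ne_zero hz
  let _ : Invertible z⁻¹ := invertibleOfNonzero hz'
  have h := eval₂_reflect_mul_pow (RingHom.id ℂ) z⁻¹ n (Q.map (starRingEnd ℂ))
    ((natDegree_map_le).trans hQ)
  rw [invOf_eq_inv, inv_inv] at h
  change eval z (reversedConj n Q) * z⁻¹ ^ n = eval z⁻¹ (Q.map (starRingEnd ℂ)) at h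
  have h2 : eval z⁻¹ (Q.map (starRingEnd ℂ)) = conj (Q.eval (1 / conj z)) := by
    have h3 := eval_map_apply (p := Q) (starRingEnd ℂ) (1 / conj z)
    simpa using h3
  rw [← h2, ← h, inv_pow, mul_comm, mul_assoc, inv_mul_cancel₀ (pow_ne_zero n hz), mul_one]

theorem polyInner_conj_symm (μ : Measure unitCircle) (p q : ℂ[X]) :
    polyInner μ q p = conj (polyInner μ p q) := by
  unfold polyInner
  rw [← integral_conj]
  congr 1
  ext z
  simp [mul_comm]

theorem integrable_poly (μ : Measure unitCircle) [IsFiniteMeasure μ] (p q : ℂ[X]) :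
    Integrable (fun z : unitCircle => p.eval (z : ℂ) * conj (q.eval (z : ℂ))) μ := by
  have hc : Continuous (fun z : unitCircle => p.eval (z : ℂ) * conj (q.eval (z : ℂ))) := by
    fun_prop
  exact hc.integrable_of_hasCompactSupport (HasCompactSupport.of_compactSpace _)

theorem polyInner_sub_left (μ : Measure unitCircle) [IsFiniteMeasure μ] (p q r : ℂ[X]) :
    polyInner μ (p - q) r = polyInner μ p r - polyInner μ q r := by
  unfold polyInner
  rw [← integral_sub (integrable_poly μ p r) (integrable_poly μ q r)]
  simp [sub_mul]

theorem polyInner_sum_C_mul_left (μ : Measure unitCircle) [IsFiniteMeasure μ] {ι : Type*}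
    (s : Finset ι) (a : ι → ℂ) (f : ι → ℂ[X]) (r : ℂ[X]) :
    polyInner μ (∑ k ∈ s, C (a k) * f k) r = ∑ k ∈ s, a k * polyInner μ (f k) r := by
  unfold polyInner
  simp_rw [← integral_const_mul]
  rw [← integral_finsetSum s (fun k _ => (integrable_poly μ (f k) r).const_mul (a k))]
  simp [eval_finsetSum, Finset.sum_mul, mul_assoc]

theorem eq_zero_of_polyInner_self {μ : Measure unitCircle} [IsFiniteMeasure μ]
    (hμ : μ.support.Infinite) {p : ℂ[X]} (hp : polyInner μ p p = 0) : p = 0 := by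
  by_contra hne
  have hc : Continuous (fun z : unitCircle => ‖p.eval (z : ℂ)‖ ^ 2) := by fun_prop
  have hint : Integrable (fun z : unitCircle => ‖p.eval (z : ℂ)‖ ^ 2) μ :=
    hc.integrable_of_hasCompactSupport (HasCompactSupport.of_compactSpace _)
  have h0 : ∫ z : unitCircle, ‖p.eval (z : ℂ)‖ ^ 2 ∂μ = 0 := by
    have h1 : polyInner μ p p = ((∫ z : unitCircle, ‖p.eval (z : ℂ)‖ ^ 2 ∂μ : ℝ) : ℂ) := by
      rw [← integral_complex_ofReal]
      unfold polyInner
      congr 1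
      ext z
      rw [Complex.mul_conj, Complex.normSq_eq_norm_sq]
    rw [h1] at hp
    exact_mod_cast hp
  have hae := (integral_eq_zero_iff_of_nonneg (fun z => by positivity) hint).1 h0
  apply hμ
  have hfin : ((fun z : unitCircle => (z : ℂ)) ⁻¹' {z | p.IsRoot z}).Finite :=
    (finite_setOfPred_isRoot hne).preimage Subtype.val_injective.injOn
  refine hfin.subset ?_
  refine Measure.support_subset_of_isClosed ?_ ?_
  · have : IsClosed {z : unitCircle | p.eval (z : ℂ) = 0} :=
      isClosed_eq (by fun_prop) continuous_const
    exact this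
  · filter_upwards [hae] with z hz
    simpa using hz

theorem monic_opuc_and_natDegree (μ : Measure unitCircle) (n : ℕ) :
    (opuc μ n).Monic ∧ (opuc μ n).natDegree = n := by
  induction n using Nat.strong_induction_on with
  | _ n ih =>
    have hdeg : (∑ k : Fin n, C (polyInner μ (X ^ n) (opuc μ k) /
        polyInner μ (opuc μ k) (opuc μ k)) * opuc μ k).degree < n := by
      refine (degree_sum_le _ _).trans_lt ?_
      refine (Finset.sup_lt_iff (WithBot.bot_lt_coe n)).2 ?_
      intro k _
      rw [C_mul']
      refine (degree_smul_le _ _).trans_lt ?_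
      rw [degree_eq_natDegree (ih k k.2).1.ne_zero, (ih k k.2).2]
      exact WithBot.coe_lt_coe.2 k.2
    rw [opuc]
    refine ⟨(monic_X_pow n).sub_of_left (by rwa [degree_X_pow]), ?_⟩
    apply natDegree_eq_of_degree_eq_some
    rw [degree_sub_eq_left_of_degree_lt (by rwa [degree_X_pow]), degree_X_pow]

/-- The Gram-Schmidt construction yields a sequence of monic OPUC. -/
theorem isMonicOPUC_opuc (μ : Measure unitCircle) [IsFiniteMeasure μ]
    (hμ : μ.support.Infinite) : IsMonicOPUC μ (opuc μ) := by
  have hnorm : ∀ n, polyInner μ (opuc μ n) (opuc μ n) ≠ 0 := fun n h =>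
    (monic_opuc_and_natDegree μ n).1.ne_zero (eq_zero_of_polyInner_self hμ h)
  have horth : ∀ n, ∀ m < n, polyInner μ (opuc μ n) (opuc μ m) = 0 := by
    intro n
    induction n using Nat.strong_induction_on with
    | _ n ih =>
      intro m hm
      rw [opuc, polyInner_sub_left, polyInner_sum_C_mul_left,
        Finset.sum_eq_single (⟨m, hm⟩ : Fin n), div_mul_cancel₀ _ (hnorm m), sub_self]
      · intro k _ hk
        have hkm : (k : ℕ) ≠ m := fun h => hk (Fin.ext h)
        rcases lt_or_gt_of_ne hkm with h | h
        · rw [polyInner_conj_symm μ (opuc μ m), ih m hm k h, map_zero, mul_zero]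
        · rw [ih k k.2 m h, mul_zero]
      · simp
  refine ⟨fun n => (monic_opuc_and_natDegree μ n).1, fun n => (monic_opuc_and_natDegree μ n).2,
    fun n m hnm => ?_, hnorm⟩
  rcases lt_or_gt_of_ne hnm with h | h
  · rw [polyInner_conj_symm, horth m n h, map_zero]
  · exact horth n m h

theorem IsMonicOPUC.polyInner_eq_zero {μ : Measure unitCircle} [IsFiniteMeasure μ]
    {Q : ℕ → ℂ[X]} (hQ : IsMonicOPUC μ Q) {n : ℕ} {p : ℂ[X]} (hp : p.degree < n) :
    polyInner μ p (Q n) = 0 := by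
  induction hd : p.natDegree using Nat.strong_induction_on generalizing p with
  | _ d ih =>
    by_cases h0 : p = 0
    · simp [h0, polyInner]
    have hdn : d < n := by
      rw [degree_eq_natDegree h0, hd] at hp
      exact_mod_cast hp
    set r : ℂ[X] := p - C p.leadingCoeff * Q d with hr
    have hlin : polyInner μ r (Q n) = polyInner μ p (Q n) := by
      have h1 := polyInner_sum_C_mul_left μ {d} (fun _ => p.leadingCoeff) Q (Q n)
      rw [Finset.sum_singleton, Finset.sum_singleton, hQ.orthogonal d n hdn.ne, mul_zero] at h1
      rw [hr, polyInner_sub_left, h1, sub_zero]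
    have hdeg : r.degree < p.degree := by
      have hlc : p.leadingCoeff ≠ 0 := leadingCoeff_ne_zero.2 h0
      apply degree_sub_lt_left
      · rw [degree_C_mul hlc, degree_eq_natDegree (hQ.monic d).ne_zero, hQ.natDegree_eq,
          degree_eq_natDegree h0, hd]
      · exact h0
      · rw [leadingCoeff_mul, leadingCoeff_C, (hQ.monic d).leadingCoeff, mul_one]
    rw [← hlin]
    by_cases hr0 : r = 0
    · simp [hr0, polyInner]
    · exact ih r.natDegree (by rw [← hd]; exact natDegree_lt_natDegree hr0 hdeg)
        (hdeg.trans hp) rfl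

/-- The sequence of monic OPUC of a finite measure with infinite support is unique. -/
theorem IsMonicOPUC.eq_opuc {μ : Measure unitCircle} [IsFiniteMeasure μ]
    (hμ : μ.support.Infinite) {Q : ℕ → ℂ[X]} (hQ : IsMonicOPUC μ Q) : Q = opuc μ := by
  funext n
  have hO := isMonicOPUC_opuc μ hμ
  have hdeg : (Q n - opuc μ n).degree < n := by
    have hd : ∀ {R : ℕ → ℂ[X]}, IsMonicOPUC μ R → (R n).degree = n := fun hR => by
      rw [degree_eq_natDegree (hR.monic n).ne_zero, hR.natDegree_eq]
    have h := degree_sub_lt_left (p := Q n) (q := opuc μ n) ((hd hQ).trans (hd hO).symm)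
      (hQ.monic n).ne_zero ((hQ.monic n).leadingCoeff.trans (hO.monic n).leadingCoeff.symm)
    rwa [hd hQ] at h
  have h1 := hQ.polyInner_eq_zero hdeg
  have h2 := hO.polyInner_eq_zero hdeg
  refine sub_eq_zero.1 (eq_zero_of_polyInner_self hμ ?_)
  rw [polyInner_sub_left, polyInner_conj_symm μ (Q n - opuc μ n) (Q n),
    polyInner_conj_symm μ (Q n - opuc μ n) (opuc μ n), h1, h2]
  simp

end POPUC

namespace POPUC

open Complex

/-! Dividing by `Q_{n-1}^*`, the equation `P(z; b) = 0` becomes `B(z) = conj b`, where `B(z) = z ∏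
(z - a) / (1 - conj a * z)` runs over the zeros `a` of `Q_{n-1}`. These lie in the open disk
(`norm_lt_one_of_isRoot_opuc`), so `B` is a Blaschke product, and on the circle `B(e^{iθ}) =
e^{iF(θ)}` with `F' ≥ 1` (`exists_argument_blaschke`). Hence `F` has a differentiable inverse `G` on
all of `ℝ` (`exists_hasDerivAt_inverse`), which replaces the implicit function theorem. If `conj (b
t) = e^{iβ(t)}`, with `β` the branch for which `G(β(t₀))` is an argument of `ζ₀`, the zero is `ζ(t)
= e^{iG(β(t))}`. Since `β' = i * conj b * b'` and `G' > 0`, the sign of that expression gives the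
direction of motion. -/

/-! ### Zeros of the orthogonal polynomials. -/

theorem polyInner_X_mul_X_mul (μ : Measure unitCircle) [IsFiniteMeasure μ] (p : ℂ[X]) :
    polyInner μ (X * p) (X * p) = polyInner μ p p := by
  unfold polyInner
  congr 1
  ext z
  have hz : (z : ℂ) * conj (z : ℂ) = 1 := by
    rw [mul_conj, normSq_eq_norm_sq, mem_sphere_zero_iff_norm.1 z.2]
    simp
  simp only [eval_mul, eval_X, map_mul]
  linear_combination (eval (z : ℂ) p * conj (eval (z : ℂ) p)) * hz

theorem polyInner_self (μ : Measure unitCircle) (p : ℂ[X]) :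
    polyInner μ p p = ((∫ z : unitCircle, ‖p.eval (z : ℂ)‖ ^ 2 ∂μ : ℝ) : ℂ) := by
  rw [← integral_complex_ofReal]
  unfold polyInner
  congr 1
  ext z
  rw [mul_conj, normSq_eq_norm_sq]

theorem polyInner_self_re_nonneg (μ : Measure unitCircle) (p : ℂ[X]) :
    0 ≤ (polyInner μ p p).re := by
  rw [polyInner_self, ofReal_re]
  exact integral_nonneg fun z => by positivity

theorem polyInner_add_C_mul_self {μ : Measure unitCircle} [IsFiniteMeasure μ] {p q : ℂ[X]}
    (h : polyInner μ p q = 0) (a : ℂ) :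
    polyInner μ (q + C a * p) (q + C a * p) =
      polyInner μ q q + a * conj a * polyInner μ p p := by
  have h' : polyInner μ q p = 0 := by rw [polyInner_conj_symm, h, map_zero]
  have hexp : polyInner μ (q + C a * p) (q + C a * p) =
      polyInner μ q q + a * polyInner μ p q +
        (conj a * polyInner μ q p + a * conj a * polyInner μ p p) := by
    unfold polyInner
    simp_rw [← integral_const_mul]
    rw [← integral_add (integrable_poly μ q q) ((integrable_poly μ p q).const_mul _),
      ← integral_add ((integrable_poly μ q p).const_mul _) ((integrable_poly μ p p).const_mul _),
      ← integral_add]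
    · congr 1
      ext z
      simp only [eval_add, eval_mul, eval_C, map_add, map_mul]
      ring
    · exact (integrable_poly μ q q).add ((integrable_poly μ p q).const_mul _)
    · exact ((integrable_poly μ q p).const_mul _).add ((integrable_poly μ p p).const_mul _)
  rw [hexp, h, h']
  ring

/-- The zeros of the orthogonal polynomials lie in the open unit disk. -/
theorem norm_lt_one_of_isRoot_opuc {μ : Measure unitCircle} [IsFiniteMeasure μ]
    (hμ : μ.support.Infinite) {m : ℕ} {a : ℂ} (ha : (opuc μ m).IsRoot a) : ‖a‖ < 1 := by
  obtain ⟨R, hR⟩ := dvd_iff_isRoot.2 ha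
  have hO := isMonicOPUC_opuc μ hμ
  have hQ0 := (hO.monic m).ne_zero
  have hR0 : R ≠ 0 := by
    rintro rfl
    exact hQ0 (by rw [hR, mul_zero])
  have hdeg : R.degree < m := by
    have h1 : (opuc μ m).natDegree = 1 + R.natDegree := by
      rw [hR, natDegree_mul (X_sub_C_ne_zero a) hR0, natDegree_X_sub_C]
    rw [hO.natDegree_eq] at h1
    rw [degree_eq_natDegree hR0]
    exact_mod_cast (by omega : R.natDegree < m)
  -- Multiplication by `z` is an isometry and `Q ⟂ R`, so `‖R‖² = ‖zR‖² = ‖Q‖² + |a|² ‖R‖²` with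
  -- `‖Q‖ > 0`, which forces `|a| < 1`.
  have hX : X * R = opuc μ m + C a * R := by
    rw [hR]
    ring
  have hkey := polyInner_X_mul_X_mul μ R
  rw [hX, polyInner_add_C_mul_self (hO.polyInner_eq_zero hdeg)] at hkey
  have hkey' := congrArg re hkey
  rw [add_re, mul_conj, re_ofReal_mul, normSq_eq_norm_sq] at hkey'
  have hpos : ∀ p : ℂ[X], p ≠ 0 → 0 < (polyInner μ p p).re := fun p hp => by
    refine (polyInner_self_re_nonneg μ p).lt_of_ne fun h => hp (eq_zero_of_polyInner_self hμ ?_)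
    rw [polyInner_self, ofReal_re] at h
    rw [polyInner_self, ← h, ofReal_zero]
  have h1 := hpos _ hQ0
  have h2 := hpos _ hR0
  by_contra! h
  nlinarith [mul_le_mul_of_nonneg_right (one_le_pow₀ (n := 2) h) h2.le]

/-! ### Factorisation over the zeros, and location of the zeros of the POPUC. -/

/-- Each of the `natDegree` powers of `z` is paired with one root: `z * conj (1 / conj z - a) = 1 -
conj a * z`. The point `z = 0` is read off the leading coefficient. -/
theorem reversedConj_eval_eq_prod {Q : ℂ[X]} (hQ : Q.Monic) (z : ℂ) :
    (reversedConj Q.natDegree Q).eval z = (Q.roots.map fun a => 1 - conj a * z).prod := by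
  have hsplit := IsAlgClosed.splits Q
  have hcard : Q.roots.card = Q.natDegree := hsplit.natDegree_eq_card_roots.symm
  rcases eq_or_ne z 0 with rfl | hz
  · rw [← coeff_zero_eq_eval_zero, reversedConj, coeff_reflect, revAt_zero, coeff_map,
      coeff_natDegree, hQ.leadingCoeff]
    simp
  · rw [eval_reversedConj le_rfl hz, ← hcard]
    have : Q.eval (1 / conj z) = (Q.roots.map fun a => 1 / conj z - a).prod := by
      conv_lhs => rw [hsplit.eq_prod_roots_of_monic hQ]
      rw [eval_multiset_prod, Multiset.map_map]
      simp
    rw [this]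
    induction Q.roots using Multiset.induction_on with
    | empty => simp
    | cons a s ih =>
      rw [Multiset.map_cons, Multiset.prod_cons, Multiset.map_cons, Multiset.prod_cons, ← ih]
      simp only [Multiset.card_cons, map_mul, map_sub, map_div₀, map_one, conj_conj]
      field_simp
      ring

theorem eval_eq_prod_roots {Q : ℂ[X]} (hQ : Q.Monic) (z : ℂ) :
    Q.eval z = (Q.roots.map fun a => z - a).prod := by
  conv_lhs => rw [(IsAlgClosed.splits Q).eq_prod_roots_of_monic hQ]
  rw [eval_multiset_prod, Multiset.map_map]
  simp

theorem popuc_eval_eq (μ : Measure unitCircle) (n : ℕ) (b z : ℂ) :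
    (popuc μ n b).eval z = z * ((opuc μ (n - 1)).roots.map fun a => z - a).prod -
      conj b * ((opuc μ (n - 1)).roots.map fun a => 1 - conj a * z).prod := by
  obtain ⟨hm, hd⟩ := monic_opuc_and_natDegree μ (n - 1)
  rw [popuc, eval_sub, eval_mul, eval_mul, eval_X, eval_C, ← eval_eq_prod_roots hm,
    ← reversedConj_eval_eq_prod hm, hd]

theorem one_sub_conj_mul_ne_zero {a z : ℂ} (ha : ‖a‖ < 1) (hz : ‖z‖ ≤ 1) :
    1 - conj a * z ≠ 0 := by
  intro h
  have h1 : ‖conj a * z‖ = 1 := by rw [← sub_eq_zero.1 h, norm_one]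
  rw [norm_mul, norm_conj] at h1
  nlinarith [norm_nonneg a, norm_nonneg z]

theorem prod_one_sub_conj_mul_ne_zero {s : Multiset ℂ} (hs : ∀ a ∈ s, ‖a‖ < 1) {z : ℂ}
    (hz : ‖z‖ ≤ 1) : (s.map fun a => 1 - conj a * z).prod ≠ 0 := by
  rw [ne_eq, Multiset.prod_eq_zero_iff]
  simp only [Multiset.mem_map, not_exists, not_and]
  exact fun a ha => one_sub_conj_mul_ne_zero (hs a ha) hz

/-- For `|a| < 1`, the sign of `1 - |z|` decides which of the two factors is larger; this drives
both product estimates below. -/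
theorem norm_sq_one_sub_conj_mul_sub (a z : ℂ) :
    ‖1 - conj a * z‖ ^ 2 - ‖z - a‖ ^ 2 = (1 - ‖a‖ ^ 2) * (1 - ‖z‖ ^ 2) := by
  simp only [← normSq_eq_norm_sq, normSq_apply, sub_re, sub_im, mul_re, mul_im, conj_re, conj_im,
    one_re, one_im]
  ring

theorem norm_prod_sub_le {s : Multiset ℂ} (hs : ∀ a ∈ s, ‖a‖ < 1) {z : ℂ} (hz : ‖z‖ ≤ 1) :
    ‖(s.map fun a => z - a).prod‖ ≤ ‖(s.map fun a => 1 - conj a * z).prod‖ := by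
  induction s using Multiset.induction_on with
  | empty => simp
  | cons a s ih =>
    simp only [Multiset.map_cons, Multiset.prod_cons, norm_mul]
    gcongr
    · refine le_of_sq_le_sq ?_ (norm_nonneg _)
      have ha := hs a (Multiset.mem_cons_self a s)
      have h1 : 0 ≤ 1 - ‖a‖ ^ 2 := by nlinarith [norm_nonneg a]
      have h2 : 0 ≤ 1 - ‖z‖ ^ 2 := by nlinarith [norm_nonneg z]
      linarith [norm_sq_one_sub_conj_mul_sub a z, mul_nonneg h1 h2]
    · exact ih fun a ha => hs a (Multiset.mem_cons_of_mem ha)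

theorem norm_prod_one_sub_conj_mul_le {s : Multiset ℂ} (hs : ∀ a ∈ s, ‖a‖ < 1) {z : ℂ}
    (hz : 1 ≤ ‖z‖) :
    ‖(s.map fun a => 1 - conj a * z).prod‖ ≤ ‖(s.map fun a => z - a).prod‖ := by
  induction s using Multiset.induction_on with
  | empty => simp
  | cons a s ih =>
    simp only [Multiset.map_cons, Multiset.prod_cons, norm_mul]
    gcongr
    · refine le_of_sq_le_sq ?_ (norm_nonneg _)
      have ha := hs a (Multiset.mem_cons_self a s)
      have h1 : 0 ≤ 1 - ‖a‖ ^ 2 := by nlinarith [norm_nonneg a]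
      have h2 : 0 ≤ ‖z‖ ^ 2 - 1 := by nlinarith [norm_nonneg z]
      linarith [norm_sq_one_sub_conj_mul_sub a z, mul_nonneg h1 h2]
    · exact ih fun a ha => hs a (Multiset.mem_cons_of_mem ha)

/-- The zeros of `z ∏ (z - a) - c ∏ (1 - conj a * z)` with `‖c‖ = 1` lie on the unit circle. -/
theorem norm_eq_one_of_blaschke {s : Multiset ℂ} (hs : ∀ a ∈ s, ‖a‖ < 1) {c z : ℂ} (hc : ‖c‖ = 1)
    (h : z * (s.map fun a => z - a).prod = c * (s.map fun a => 1 - conj a * z).prod) :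
    ‖z‖ = 1 := by
  have hnorm := congrArg norm h
  rw [norm_mul, norm_mul, hc, one_mul] at hnorm
  rcases lt_trichotomy ‖z‖ 1 with hz | hz | hz
  · have h1 := norm_prod_sub_le hs hz.le
    have h2 := norm_pos_iff.2 (prod_one_sub_conj_mul_ne_zero hs hz.le)
    nlinarith [norm_nonneg z]
  · exact hz
  · have h1 := norm_prod_one_sub_conj_mul_le hs hz.le
    have h2 : 0 < ‖(s.map fun a => z - a).prod‖ := by
      rw [norm_pos_iff, ne_eq, Multiset.prod_eq_zero_iff]
      simp only [Multiset.mem_map, not_exists, not_and, sub_eq_zero]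
      rintro a ha rfl
      exact (hs _ ha).not_gt hz
    nlinarith [norm_nonneg z]

/-! ### The argument of a Blaschke product along the circle. -/

theorem exp_two_arg_mul_conj (w : ℂ) : cexp ((2 * arg w : ℝ) * I) * conj w = w := by
  have h := norm_mul_exp_arg_mul_I w
  have h2 : conj w = ‖w‖ * cexp (-(arg w * I)) := by
    conv_lhs => rw [← h]
    rw [map_mul, conj_ofReal, ← exp_conj, map_mul, conj_ofReal, conj_I, mul_neg]
  conv_rhs => rw [← h]
  rw [h2, mul_left_comm, ← Complex.exp_add]
  congr 2
  push_cast
  ring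

theorem hasDerivAt_exp_ofReal_mul_I (θ : ℝ) :
    HasDerivAt (fun t : ℝ => cexp (t * I)) (cexp (θ * I) * I) θ := by
  have h := ((hasDerivAt_id θ).ofReal_comp.mul_const I).cexp
  simpa using h

theorem hasDerivAt_arg_comp {f : ℝ → ℂ} {f' : ℂ} {t : ℝ} (hf : HasDerivAt f f' t)
    (h : f t ∈ slitPlane) : HasDerivAt (fun s => arg (f s)) (f' / f t).im t := by
  have h1 := (imCLM.hasFDerivAt.comp_hasDerivAt t (hf.clog_real h))
  simpa [Function.comp_def, log_im] using h1

/-- A continuous choice of the argument of a disk automorphism along the unit circle. -/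
theorem exists_argument_factor {a : ℂ} (ha : ‖a‖ < 1) :
    ∃ f f' : ℝ → ℝ, (∀ θ, HasDerivAt f (f' θ) θ) ∧ (∀ θ, 0 ≤ f' θ) ∧
      ∀ θ : ℝ, cexp (θ * I) - a = cexp (f θ * I) * (1 - conj a * cexp (θ * I)) := by
  -- For `z = e^{iθ}`, `z - a = z * w` and `1 - conj a * z = conj w`, so the quotient has argument
  -- `θ + 2 arg w`. As `Re w > 0`, the principal branch is differentiable.
  set w : ℝ → ℂ := fun θ => 1 - a * cexp (-(θ * I)) with hw
  have hu : ∀ θ : ℝ, ‖a * cexp (-(θ * I))‖ < 1 := fun θ => by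
    rw [norm_mul, ← neg_mul, ← ofReal_neg, norm_exp_ofReal_mul_I, mul_one]
    exact ha
  have hre : ∀ θ, 0 < (w θ).re := fun θ => by
    have := (re_le_norm (a * cexp (-(θ * I)))).trans_lt (hu θ)
    simp only [hw, sub_re, one_re]
    linarith
  have hwd : ∀ θ : ℝ, HasDerivAt w (a * cexp (-(θ * I)) * I) θ := fun θ => by
    have h : HasDerivAt (fun s : ℝ => -(s * I : ℂ)) (-(1 * I)) θ :=
      ((hasDerivAt_id θ).ofReal_comp.mul_const I).neg
    refine ((h.cexp.const_mul a).const_sub 1).congr_deriv ?_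
    ring
  refine ⟨fun θ => θ + 2 * arg (w θ), fun θ => 1 + 2 * (a * cexp (-(θ * I)) * I / w θ).im,
    fun θ => (hasDerivAt_id θ).add ((hasDerivAt_arg_comp (hwd θ) (Or.inl (hre θ))).const_mul 2),
    fun θ => ?_, fun θ => ?_⟩
  · have h1 := hu θ
    have h2 := hre θ
    simp only [hw] at h2 ⊢
    generalize a * cexp (-(θ * I)) = u at h1 h2
    have h3 : u.re ^ 2 + u.im ^ 2 < 1 := by
      have := normSq_eq_norm_sq u
      rw [normSq_apply] at this
      nlinarith [norm_nonneg u]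
    have h4 : 0 < normSq (1 - u) := normSq_pos.2 fun h => by simp [h] at h2
    -- The derivative is the Poisson kernel `(1 - |u|²) / |1 - u|²`.
    have h5 : 1 + 2 * (u * I / (1 - u)).im = (1 - (u.re ^ 2 + u.im ^ 2)) / normSq (1 - u) := by
      rw [eq_div_iff h4.ne', div_im, add_mul, mul_assoc, sub_mul, div_mul_cancel₀ _ h4.ne',
        div_mul_cancel₀ _ h4.ne', normSq_apply]
      simp only [mul_re, mul_im, sub_re, sub_im, one_re, one_im, I_re, I_im]
      ring
    rw [h5]
    exact div_nonneg (by linarith) h4.le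
  · have h := exp_two_arg_mul_conj (w θ)
    have hconj : conj (w θ) = 1 - conj a * cexp (θ * I) := by
      simp [hw, ← exp_conj]
    have hmul : cexp (θ * I) * w θ = cexp (θ * I) - a := by
      simp only [hw]
      rw [mul_sub, mul_left_comm, ← Complex.exp_add]
      simp
    rw [← hconj, ofReal_add, add_mul, Complex.exp_add, mul_assoc, h, hmul]

/-- A differentiable argument, with derivative at least `1`, of the Blaschke product
`z ∏ (z - a) / (1 - conj a * z)` along the unit circle. -/
theorem exists_argument_blaschke {s : Multiset ℂ} (hs : ∀ a ∈ s, ‖a‖ < 1) :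
    ∃ F F' : ℝ → ℝ, (∀ θ, HasDerivAt F (F' θ) θ) ∧ (∀ θ, 1 ≤ F' θ) ∧
      ∀ θ : ℝ, cexp (θ * I) * (s.map fun a => cexp (θ * I) - a).prod =
        cexp (F θ * I) * (s.map fun a => 1 - conj a * cexp (θ * I)).prod := by
  induction s using Multiset.induction_on with
  -- The lone factor `z` already supplies the lower bound `1`.
  | empty => exact ⟨id, fun _ => 1, hasDerivAt_id, fun _ => le_rfl, fun θ => by simp⟩
  | cons a s ih =>
    obtain ⟨F, F', hF, hF1, hFe⟩ := ih fun a ha => hs a (Multiset.mem_cons_of_mem ha)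
    obtain ⟨f, f', hf, hf0, hfe⟩ := exists_argument_factor (hs a (Multiset.mem_cons_self a s))
    refine ⟨fun θ => F θ + f θ, fun θ => F' θ + f' θ, fun θ => (hF θ).add (hf θ),
      fun θ => by linarith [hF1 θ, hf0 θ], fun θ => ?_⟩
    simp only [Multiset.map_cons, Multiset.prod_cons]
    rw [mul_left_comm, hFe θ, ofReal_add, add_mul, Complex.exp_add]
    linear_combination (cexp (F θ * I) * (s.map fun a => 1 - conj a * cexp (θ * I)).prod) * hfe θ

/-! ### Inverting the argument, and its application to the POPUC. -/

/-- A real function whose derivative is at least `1` has a differentiable inverse. -/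
theorem exists_hasDerivAt_inverse {F F' : ℝ → ℝ} (hF : ∀ θ, HasDerivAt F (F' θ) θ)
    (hF1 : ∀ θ, 1 ≤ F' θ) :
    ∃ G : ℝ → ℝ, (∀ x, F (G x) = x) ∧ (∀ θ, G (F θ) = θ) ∧
      ∀ x, HasDerivAt G (F' (G x))⁻¹ x := by
  have hcont : Continuous F := continuous_iff_continuousAt.2 fun θ => (hF θ).continuousAt
  have hmono : StrictMono F := strictMono_of_deriv_pos fun θ => by
    rw [(hF θ).deriv]
    linarith [hF1 θ]
  have hsub : ∀ θ, HasDerivAt (fun θ => F θ - θ) (F' θ - 1) θ := fun θ =>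
    (hF θ).sub (hasDerivAt_id θ)
  -- Comparison with `F 0 + θ` makes `F` tend to `±∞`, hence surjective.
  have hmono' : Monotone fun θ => F θ - θ :=
    monotone_of_deriv_nonneg (fun θ => (hsub θ).differentiableAt) fun θ => by
      rw [(hsub θ).deriv]
      linarith [hF1 θ]
  have hsurj : Function.Surjective F := by
    refine hcont.surjective ?_ ?_
    · refine Filter.tendsto_atTop_mono' _ ?_
        (Filter.tendsto_atTop_add_const_left _ (F 0) Filter.tendsto_id)
      filter_upwards [Filter.eventually_ge_atTop 0] with θ hθ
      have := hmono' hθ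
      simp only [id] at *
      linarith
    · refine Filter.tendsto_atBot_mono' _ ?_
        (Filter.tendsto_atBot_add_const_left _ (F 0) Filter.tendsto_id)
      filter_upwards [Filter.eventually_le_atBot 0] with θ hθ
      have := hmono' hθ
      simp only [id] at *
      linarith
  let e := hmono.orderIsoOfSurjective F hsurj
  have h1 : ∀ x, F (e.symm x) = x := fun x => e.apply_symm_apply x
  refine ⟨e.symm, h1, fun θ => e.symm_apply_apply θ, fun x => ?_⟩
  exact (hF _).of_local_left_inverse e.symm.continuous.continuousAt
    (by linarith [hF1 (e.symm x)]) (Filter.Eventually.of_forall h1)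

theorem eq_of_exp_mul_I_eq {x y : ℝ} (h : cexp (x * I) = cexp (y * I))
    (hxy : |x - y| < 2 * Real.pi) : x = y := by
  obtain ⟨k, hk⟩ := exp_eq_exp_iff_exists_int.1 h
  have hk' : x = y + k * (2 * Real.pi) := by
    have := congrArg im hk
    simpa using this
  have hk0 : |(k : ℝ)| < 1 := by
    rw [hk', add_sub_cancel_left, abs_mul, abs_of_pos Real.two_pi_pos] at hxy
    have := Real.two_pi_pos
    by_contra! hh
    nlinarith
  have : k = 0 := by
    rw [← Int.abs_lt_one_iff]
    exact_mod_cast hk0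
  simp [hk', this]

theorem exp_arg_mul_I_of_norm_eq_one {w : ℂ} (hw : ‖w‖ = 1) : cexp (arg w * I) = w := by
  have := norm_mul_exp_arg_mul_I w
  rwa [hw, ofReal_one, one_mul] at this

/-- On the unit circle, the zeros of the paraorthogonal polynomial are the points at which a
strictly increasing differentiable argument takes the value `arg (conj b)` modulo `2π`. -/
theorem exists_argument_popuc {μ : Measure unitCircle} [IsFiniteMeasure μ]
    (hμ : μ.support.Infinite) (n : ℕ) :
    ∃ F F' : ℝ → ℝ, (∀ θ, HasDerivAt F (F' θ) θ) ∧ (∀ θ, 1 ≤ F' θ) ∧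
      ∀ (b : ℂ) (θ : ℝ),
        (popuc μ n b).eval (cexp (θ * I)) = 0 ↔ cexp (F θ * I) = conj b := by
  have hs : ∀ a ∈ (opuc μ (n - 1)).roots, ‖a‖ < 1 := fun a ha =>
    norm_lt_one_of_isRoot_opuc hμ (isRoot_of_mem_roots ha)
  obtain ⟨F, F', hF, hF1, hFe⟩ := exists_argument_blaschke hs
  refine ⟨F, F', hF, hF1, fun b θ => ?_⟩
  rw [popuc_eval_eq, hFe, ← sub_mul, mul_eq_zero, sub_eq_zero]
  exact or_iff_left (prod_one_sub_conj_mul_ne_zero hs (norm_exp_ofReal_mul_I θ).le)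

theorem norm_eq_one_of_popuc_eval_eq_zero {μ : Measure unitCircle} [IsFiniteMeasure μ]
    (hμ : μ.support.Infinite) {n : ℕ} {b z : ℂ} (hb : ‖b‖ = 1)
    (hz : (popuc μ n b).eval z = 0) : ‖z‖ = 1 := by
  rw [popuc_eval_eq, sub_eq_zero] at hz
  exact norm_eq_one_of_blaschke (fun a ha => norm_lt_one_of_isRoot_opuc hμ (isRoot_of_mem_roots ha))
    (by rwa [norm_conj]) hz

end POPUC

/-! ### The motion of a zero. -/

theorem proposition3p8
    (μ : Measure POPUC.unitCircle) [IsFiniteMeasure μ] (hμ : μ.support.Infinite)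
    (n : ℕ) (hn : 1 ≤ n)
    (J : Set ℝ) (hJ_open : IsOpen J) (hJ_interval : J.OrdConnected)
    (t₀ : ℝ) (ht₀ : t₀ ∈ J)
    (b : ℝ → ℂ) (hb : ∀ t ∈ J, b t ∈ POPUC.unitCircle)
    (hb_diff : ∀ᶠ t in 𝓝 t₀, DifferentiableAt ℝ b t)
    (ζ₀ : ℂ) (hζ₀ : (POPUC.popuc μ n (b t₀)).eval ζ₀ = 0) :
    ∃ ε > (0 : ℝ), ∃ δ > (0 : ℝ), Set.Ioo (t₀ - ε) (t₀ + ε) ⊆ J ∧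
      ∃ ζ : ℝ → ℂ,
        ζ t₀ = ζ₀ ∧
        -- existence and local uniqueness of the zero
        (∀ t ∈ Set.Ioo (t₀ - ε) (t₀ + ε),
          ζ t ∈ POPUC.arc ζ₀ δ ∧
          (POPUC.popuc μ n (b t)).eval (ζ t) = 0 ∧
          ∀ z ∈ POPUC.arc ζ₀ δ, (POPUC.popuc μ n (b t)).eval z = 0 → z = ζ t) ∧
        DifferentiableOn ℝ ζ (Set.Ioo (t₀ - ε) (t₀ + ε)) ∧
        -- strict counterclockwise motion, through a differentiable argument `φ` of `ζ`
        ∃ φ : ℝ → ℝ,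
          DifferentiableOn ℝ φ (Set.Ioo (t₀ - ε) (t₀ + ε)) ∧
          (∀ t ∈ Set.Ioo (t₀ - ε) (t₀ + ε), ζ t = Complex.exp (φ t * Complex.I)) ∧
          (∀ t ∈ Set.Ioo (t₀ - ε) (t₀ + ε),
            0 < Complex.I * conj (b t) * deriv b t → 0 < deriv φ t) ∧
          (∀ K ⊆ Set.Ioo (t₀ - ε) (t₀ + ε), K.OrdConnected →
            (∀ t ∈ K, 0 < Complex.I * conj (b t) * deriv b t) → StrictMonoOn φ K) := by
  have hJ : ∀ᶠ t in 𝓝 t₀, t ∈ J := hJ_open.mem_nhds ht₀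
  have hbn : ∀ t ∈ J, ‖b t‖ = 1 := fun t ht => mem_sphere_zero_iff_norm.1 (hb t ht)
  have hζn : ‖ζ₀‖ = 1 := POPUC.norm_eq_one_of_popuc_eval_eq_zero hμ (hbn t₀ ht₀) hζ₀
  have hζ0 : ζ₀ ≠ 0 := norm_ne_zero_iff.1 (by rw [hζn]; exact one_ne_zero)
  have hb0 : conj (b t₀) * b t₀ = 1 := by
    rw [Complex.conj_mul', hbn t₀ ht₀]
    simp
  obtain ⟨F, F', hF, hF1, hFe⟩ := POPUC.exists_argument_popuc hμ n
  obtain ⟨G, hFG, hGF, hG⟩ := POPUC.exists_hasDerivAt_inverse hF hF1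
  set θ₀ : ℝ := Complex.arg ζ₀
  have hθ₀ : Complex.exp (θ₀ * Complex.I) = ζ₀ := POPUC.exp_arg_mul_I_of_norm_eq_one hζn
  have hFθ₀ : Complex.exp (F θ₀ * Complex.I) = conj (b t₀) := by
    rw [← hFe, hθ₀]
    exact hζ₀
  -- Rotating `conj b` to equal `1` at `t₀` keeps it off the branch cut of `arg` for nearby `t`.
  set g : ℝ → ℂ := fun t => conj (b t) * b t₀ with hg
  have hg0 : g t₀ = 1 := hb0
  set β : ℝ → ℝ := fun t => F θ₀ + Complex.arg (g t) with hβ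
  have hβe : ∀ t ∈ J, Complex.exp (β t * Complex.I) = conj (b t) := fun t ht => by
    have hgn : ‖g t‖ = 1 := by
      simp only [hg]
      rw [norm_mul, Complex.norm_conj, hbn t ht, hbn t₀ ht₀, mul_one]
    simp only [hβ]
    rw [Complex.ofReal_add, add_mul, Complex.exp_add, hFθ₀,
      POPUC.exp_arg_mul_I_of_norm_eq_one hgn]
    simp only [hg]
    linear_combination conj (b t) * hb0
  have hgd : ∀ t, DifferentiableAt ℝ b t →
      HasDerivAt g (conj (deriv b t) * b t₀) t := fun t ht =>
    ht.hasDerivAt.star.mul_const (b t₀)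
  have hslit : ∀ᶠ t in 𝓝 t₀, g t ∈ Complex.slitPlane := by
    refine (hgd t₀ hb_diff.self_of_nhds).continuousAt.eventually_mem
      (Complex.isOpen_slitPlane.mem_nhds ?_)
    rw [hg0]
    exact Complex.one_mem_slitPlane
  set φ : ℝ → ℝ := fun t => G (β t) with hφ
  have hφ0 : φ t₀ = θ₀ := by
    simp only [hφ, hβ, hg0, Complex.arg_one, add_zero, hGF]
  have hφd : ∀ t, DifferentiableAt ℝ b t → g t ∈ Complex.slitPlane →
      HasDerivAt φ ((F' (φ t))⁻¹ * (conj (deriv b t) * b t₀ / g t).im) t := fun t h1 h2 =>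
    (hG (β t)).comp t ((POPUC.hasDerivAt_arg_comp (hgd t h1) h2).const_add (F θ₀))
  set ζ : ℝ → ℂ := fun t => Complex.exp (φ t * Complex.I) with hζ
  have hζd : ∀ t, DifferentiableAt ℝ φ t → DifferentiableAt ℝ ζ t := fun t h =>
    ((POPUC.hasDerivAt_exp_ofReal_mul_I (φ t)).scomp t h.hasDerivAt).differentiableAt
  have hζt₀ : ζ t₀ = ζ₀ := by simp only [hζ, hφ0, hθ₀]
  -- a neighbourhood of `ζ₀` on which the argument varies by less than `π`
  have hloc : ∀ᶠ z in 𝓝 ζ₀, |F (θ₀ + Complex.arg (z / ζ₀)) - F θ₀| < Real.pi := by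
    have hc : ContinuousAt (fun z : ℂ => F (θ₀ + Complex.arg (z / ζ₀))) ζ₀ := by
      have h1 : ContinuousAt (fun z : ℂ => Complex.arg (z / ζ₀)) ζ₀ := by
        refine ContinuousAt.comp (f := fun z : ℂ => z / ζ₀) (Complex.continuousAt_arg ?_)
          (continuousAt_id.div_const ζ₀)
        rw [div_self hζ0]
        exact Complex.one_mem_slitPlane
      exact ContinuousAt.comp (g := F) (hF _).continuousAt (continuousAt_const.add h1)
    have h := Metric.tendsto_nhds.1 hc.tendsto Real.pi Real.pi_pos
    simpa [Real.dist_eq, div_self hζ0] using h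
  obtain ⟨δ, hδ, hδloc⟩ := Metric.eventually_nhds_iff_ball.1 hloc
  have hball : ∀ᶠ t in 𝓝 t₀, ζ t ∈ Metric.ball ζ₀ δ := by
    have hc := (hζd t₀ (hφd t₀ hb_diff.self_of_nhds hslit.self_of_nhds).differentiableAt).continuousAt
    refine hc.eventually_mem (Metric.isOpen_ball.mem_nhds ?_)
    rw [hζt₀]
    exact Metric.mem_ball_self hδ
  obtain ⟨ε, hε, hεall⟩ := Metric.eventually_nhds_iff_ball.1
    (hJ.and (hb_diff.and (hslit.and hball)))
  rw [Real.ball_eq_Ioo] at hεall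
  have hφd' : ∀ t ∈ Set.Ioo (t₀ - ε) (t₀ + ε), DifferentiableAt ℝ φ t := fun t ht =>
    (hφd t (hεall t ht).2.1 (hεall t ht).2.2.1).differentiableAt
  have hpos : ∀ t ∈ Set.Ioo (t₀ - ε) (t₀ + ε),
      0 < Complex.I * conj (b t) * deriv b t → 0 < deriv φ t := fun t ht h => by
    obtain ⟨htJ, hbt, hst, -⟩ := hεall t ht
    rw [(hφd t hbt hst).deriv]
    refine mul_pos (inv_pos.2 (by linarith [hF1 (φ t)])) ?_
    have hbt0 : conj (b t) * b t = 1 := by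
      rw [Complex.conj_mul', hbn t htJ]
      simp
    -- Thus `β' = Im (conj b' * b)`, which is the real part of `i * conj b * b'`.
    have hquot : conj (deriv b t) * b t₀ / g t = conj (deriv b t) * b t := by
      rw [div_eq_iff (Complex.slitPlane_ne_zero hst)]
      simp only [hg]
      linear_combination -(conj (deriv b t) * b t₀) * hbt0
    rw [hquot]
    have hre := (Complex.pos_iff.1 h).1
    simp only [Complex.mul_re, Complex.mul_im, Complex.I_re, Complex.I_im, Complex.conj_re,
      Complex.conj_im] at hre ⊢
    linarith
  refine ⟨ε, hε, δ, hδ, fun t ht => (hεall t ht).1, ζ, hζt₀, fun t ht => ?_,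
    fun t ht => (hζd t (hφd' t ht)).differentiableWithinAt, φ,
    fun t ht => (hφd' t ht).differentiableWithinAt, fun t _ => rfl, hpos, fun K hK hKc hKpos => ?_⟩
  · obtain ⟨htJ, -, -, htb⟩ := hεall t ht
    refine ⟨⟨htb, mem_sphere_zero_iff_norm.2 (Complex.norm_exp_ofReal_mul_I _)⟩, ?_, ?_⟩
    · rw [hFe]
      simp only [hφ, hFG]
      exact hβe t htJ
    · rintro z ⟨hzb, hzn⟩ hz
      rw [mem_sphere_zero_iff_norm] at hzn
      set θ : ℝ := θ₀ + Complex.arg (z / ζ₀) with hθ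
      have hzθ : Complex.exp (θ * Complex.I) = z := by
        rw [hθ, Complex.ofReal_add, add_mul, Complex.exp_add, hθ₀,
          POPUC.exp_arg_mul_I_of_norm_eq_one (by rw [norm_div, hzn, hζn, div_one]),
          mul_div_cancel₀ _ hζ0]
      rw [← hzθ, hFe, ← hβe t htJ] at hz
      -- The two arguments agree modulo `2π`; one is within less than `π` of `F θ₀`, the other
      -- within at most `π`, so they are equal.
      have hFβ : F θ = β t := by
        refine POPUC.eq_of_exp_mul_I_eq hz ?_
        have h1 := abs_lt.1 (hδloc z hzb)
        have h2 := abs_le.1 (Complex.abs_arg_le_pi (g t))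
        simp only [hβ]
        rw [abs_lt]
        constructor <;> linarith [h1.1, h1.2, h2.1, h2.2]
      rw [← hzθ]
      simp only [hζ, hφ]
      rw [← hFβ, hGF]
  · exact strictMonoOn_of_deriv_pos hKc.convex
      (fun t ht => (hφd' t (hK ht)).continuousAt.continuousWithinAt)
      fun t ht => hpos t (hK (interior_subset ht)) (hKpos t (interior_subset ht))
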